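/- Let $n\ge 1$ and let $R=GR(4,n)$ be the Galois ring, i.e. $R\cong(\mathbb Z/4)[X]/(h)$ with $h$ monic of degree $n$ and irreducible modulo $2$. Let $\xi\in R^\times$ be a unit of order $2^n-1$ and let $T=\{\xi^i : 0\le i\le 2^n-2\}\cup\{0\}$. Write $\sqrt{x}=x^{2^{n-1}}$ for $x \in R$, and $x\oplus y=x+y+2\sqrt{xy}$ for $x,y\in T$; then $(T,\oplus,\cdot)$ is a field with $2^n$ elements, and we fix an identification of $\mathbb F_{2^n}$ with it. Let $f:\mathbb F_{2^n}\to\mathbb F_{2^n}$ be pseudo-planar, i.e. for each $\epsilon\neq 0$ the map $x\mapsto f(x+\epsilon)+f(x)+\epsilon x$ is a permutation of $\mathbb F_{2^n}$, and suppose that $f(0)=0$. View $f$ as a map $T\to T$ and put $D_f=\{x+2\sqrt{f(x)} : x\in T\}\subseteq R$. For a complex character $\chi$ of the group $(R,+)$ let $\chi(D_f)=\sum_{g\in D_f}\chi(g)$. Then the multiset $\{\chi(D_f) : \chi\in\widehat R\}$, where $\widehat R$ is the group of all such characters, depends only on $n$ and is as follows. If $n$ is odd and $b=2^{(n-1)/2}$,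 it consists of - $2b^2$ with multiplicity $1$, - $0$ with multiplicity $2b^2-1$, - each of $b+b\mathbf i$ and $b-b\mathbf i$ with multiplicity $\frac{b(2b^3+2b^2-b-1)}2$, - each of $-b+b\mathbf i$ and $-b-b\mathbf i$ with multiplicity $\frac{b(2b^3-2b^2-b+1)}2$. If $n$ is even and $b=2^{(n-2)/2}$, it consists of - $4b^2$ with multiplicity $1$, - $0$ with multiplicity $4b^2-1$, - $2b$ with multiplicity $b(4b^3+4b^2-b-1)$, - $-2b$ with multiplicity $b(4b^3-4b^2-b+1)$, - each of $2b\mathbf i$ and $-2b\mathbf i$ with multiplicity $b^2(4b^2-1)$. (For $n\le 2$ some of these multiplicities are $0$.) -/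

import Mathlib

open Polynomial

/-- `R` is the Galois ring `GR(4, n)`: it is isomorphic to `(ℤ/4)[X] / (h)` for a monic polynomial
`h` of degree `n` over `ℤ/4` whose reduction modulo `2` is irreducible. -/
def IsGaloisRing (n : ℕ) (R : Type*) [CommRing R] : Prop :=
  ∃ h : (ZMod 4)[X], h.Monic ∧ h.natDegree = n ∧
    Irreducible (h.map (ZMod.castHom (by norm_num : 2 ∣ 4) (ZMod 2))) ∧
    Nonempty (R ≃+* AdjoinRoot h)

/-- The Teichmüller system `T = {ξ ^ i | 0 ≤ i ≤ 2 ^ n - 2} ∪ {0}` attached to a unit `ξ`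
(which will have order `2 ^ n - 1`). -/
def teichmullerSystem (n : ℕ) {R : Type*} [CommRing R] (ξ : Rˣ) : Set R :=
  {x | ∃ i : ℕ, i < 2 ^ n - 1 ∧ x = (ξ : R) ^ i} ∪ {0}

/-- `√x = x ^ (2 ^ (n - 1))`. -/
def galoisSqrt (n : ℕ) {R : Type*} [CommRing R] (x : R) : R := x ^ 2 ^ (n - 1)

/-- The addition `x ⊕ y = x + y + 2 √(x y)` on the Teichmüller system. -/
def teichmullerAdd (n : ℕ) {R : Type*} [CommRing R] (x y : R) : R :=
  x + y + 2 * galoisSqrt n (x * y)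

/-- An identification of a field `F` with the field `(T, ⊕, ·)`, where `T` is the Teichmüller
system: a bijection from `F` onto `T` that respects both operations. -/
structure TeichmullerIdentification (n : ℕ) {R : Type*} [CommRing R] (ξ : Rˣ)
    (F : Type*) [Field F] where
  toFun : F → R
  bijOn : Set.BijOn toFun Set.univ (teichmullerSystem n ξ)
  map_mul : ∀ x y : F, toFun (x * y) = toFun x * toFun y
  map_add : ∀ x y : F, toFun (x + y) = teichmullerAdd n (toFun x) (toFun y)

/-- `f` is pseudo-planar: `x ↦ f (x + ε) + f x + ε x` is a permutation for each `ε ≠ 0`. -/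
def IsPseudoPlanar {F : Type*} [Field F] (f : F → F) : Prop :=
  ∀ ε : F, ε ≠ 0 → Function.Bijective fun x : F => f (x + ε) + f x + ε * x

/-- `D_f = {x + 2 √(f x) | x ∈ T}`, where `f` is transported to `T` along the identification. -/
def pseudoPlanarSet (n : ℕ) {R : Type*} [CommRing R] {ξ : Rˣ} {F : Type*} [Field F]
    (φ : TeichmullerIdentification n ξ F) (f : F → F) : Set R :=
  {r | ∃ x : F, r = φ.toFun x + 2 * galoisSqrt n (φ.toFun (f x))}

open Classical in
/-- The multiset `{χ(D) | χ ∈ R̂}`, where `χ` runs over all complex characters of the additive group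
of `R` and `χ(D) = ∑ g ∈ D, χ g`. -/
noncomputable def characterSpectrum {R : Type*} [CommRing R] [Fintype R] (D : Set R) :
    Multiset ℂ :=
  (Finset.univ : Finset (AddChar R ℂ)).val.map fun χ => ∑ g ∈ D.toFinset, χ g

/-- The spectrum for odd `n`, with `b = 2 ^ ((n - 1) / 2)`. The multiplicities are computed in `ℤ`;
for powers `b` of `2` they are non-negative and the divisions by `2` are exact. -/
noncomputable def oddSpectrum (b : ℤ) : Multiset ℂ :=
  Multiset.replicate 1 (2 * (b : ℂ) ^ 2)
  + Multiset.replicate (2 * b ^ 2 - 1).toNat (0 : ℂ)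
  + Multiset.replicate (b * (2 * b ^ 3 + 2 * b ^ 2 - b - 1) / 2).toNat ((b : ℂ) + b * Complex.I)
  + Multiset.replicate (b * (2 * b ^ 3 + 2 * b ^ 2 - b - 1) / 2).toNat ((b : ℂ) - b * Complex.I)
  + Multiset.replicate (b * (2 * b ^ 3 - 2 * b ^ 2 - b + 1) / 2).toNat (-(b : ℂ) + b * Complex.I)
  + Multiset.replicate (b * (2 * b ^ 3 - 2 * b ^ 2 - b + 1) / 2).toNat (-(b : ℂ) - b * Complex.I)

/-- The spectrum for even `n`, with `b = 2 ^ ((n - 2) / 2)`. The multiplicities are computed in `ℤ`;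
for powers `b` of `2` they are non-negative. -/
noncomputable def evenSpectrum (b : ℤ) : Multiset ℂ :=
  Multiset.replicate 1 (4 * (b : ℂ) ^ 2)
  + Multiset.replicate (4 * b ^ 2 - 1).toNat (0 : ℂ)
  + Multiset.replicate (b * (4 * b ^ 3 + 4 * b ^ 2 - b - 1)).toNat (2 * (b : ℂ))
  + Multiset.replicate (b * (4 * b ^ 3 - 4 * b ^ 2 - b + 1)).toNat (-(2 * (b : ℂ)))
  + Multiset.replicate (b ^ 2 * (4 * b ^ 2 - 1)).toNat (2 * (b : ℂ) * Complex.I)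
  + Multiset.replicate (b ^ 2 * (4 * b ^ 2 - 1)).toNat (-(2 * (b : ℂ) * Complex.I))

/-!
Let `S χ = ∑ x, χ (x + 2 √(f x))`, where `x` runs over the Teichmüller system; since distinct
Teichmüller elements differ modulo `2`, this is `χ(D_f)`. The characters fall into three classes.

* `S 0 = 2 ^ n`.
* If `χ ≠ 0` is trivial on `2R`, then `χ` restricts to a nontrivial additive character of `F`, and
  `S χ` is its sum, namely `0` (`charSum_eq_zero`). There are `2 ^ n` characters trivial on `2R`
  (`card_twoChar_eq_zero`).
* If `χ` is nontrivial on `2R`, then `|S χ|² = 2 ^ n` (`charSum_mul_conj`). Indeed, writing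
  `d x = x + 2 √(f x)`, one has `d (x ⊕ ε) - d x = ε + 2 √(f (x + ε) + f x + ε x)`
  (`point_add_sub_point`); for `ε ≠ 0` pseudo-planarity makes this run over the coset `ε + 2R`, on
  which `χ` sums to zero.

In the third class `S χ` is moreover a Gaussian integer, because `R` has exponent `4`. A Gaussian
integer of norm `2 ^ n` is `±b ± bi` or one of `±2b`, `±2bi`, according to the parity of `n`
(`Int.sq_add_sq_eq_two_mul_four_pow`, `Int.sq_add_sq_eq_four_pow`).

It remains to find the multiplicities. Conjugate values are equally frequent, as `χ ↦ -χ` conjugates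
`S χ`. The total is `4 ^ n`, and `∑ S χ = 4 ^ n` by orthogonality because `0` lies once in `D_f`
(this uses `f 0 = 0`). For odd `n` these determine everything (`eq_oddSpectrum`); for even `n` one
also needs `∑ (S χ)² = 4 ^ n`, which holds because `d x + d y = 0` only for `x = y = 0`
(`eq_evenSpectrum`).
-/

/-! ### Galois rings of characteristic four -/

namespace IsGaloisRing

variable {n : ℕ} {R : Type*} [CommRing R]

theorem pos (hR : IsGaloisRing n R) : 0 < n := by
  obtain ⟨h, hm, hd, hi, -⟩ := hR
  rcases Nat.eq_zero_or_pos n with rfl | hn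
  · rw [hm.natDegree_eq_zero.mp hd, Polynomial.map_one] at hi
    exact absurd hi not_irreducible_one
  · exact hn

theorem exists_addEquiv (hR : IsGaloisRing n R) : Nonempty (R ≃+ (Fin n → ZMod 4)) := by
  obtain ⟨h, hm, hd, -, ⟨e⟩⟩ := hR
  have hdim : (AdjoinRoot.powerBasis' hm).dim = n := by
    rw [AdjoinRoot.powerBasis'_dim, hd]
  subst hdim
  exact ⟨e.toAddEquiv.trans (AdjoinRoot.powerBasis' hm).basis.equivFun.toAddEquiv⟩

theorem card_eq [Fintype R] (hR : IsGaloisRing n R) : Fintype.card R = 4 ^ n := by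
  obtain ⟨e⟩ := hR.exists_addEquiv
  rw [Fintype.card_congr e.toEquiv]
  simp

theorem four_mul_eq_zero (hR : IsGaloisRing n R) (r : R) : 4 * r = 0 := by
  obtain ⟨e⟩ := hR.exists_addEquiv
  apply e.injective
  have h4 : (4 : R) * r = 4 • r := by simp
  rw [h4, map_nsmul, map_zero]
  funext i
  simp only [Pi.smul_apply, Pi.zero_apply]
  generalize e r i = a
  revert a
  decide

/-- The annihilator of `2` is `2R`, because `R` is free over `ℤ/4`. -/
theorem two_dvd_of_two_mul_eq_zero (hR : IsGaloisRing n R) {r : R} (hr : 2 * r = 0) :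
    (2 : R) ∣ r := by
  obtain ⟨e⟩ := hR.exists_addEquiv
  have h2 (s : R) : (2 : R) * s = 2 • s := by simp
  have key : ∀ a : ZMod 4, 2 • a = 0 → ∃ c : ZMod 4, a = 2 • c := by decide
  have hcoord (i : Fin n) : ∃ c : ZMod 4, e r i = 2 • c := by
    apply key
    have := congrFun (congrArg e hr) i
    rwa [h2, map_nsmul, map_zero] at this
  choose c hc using hcoord
  refine ⟨e.symm c, e.injective ?_⟩
  rw [h2, map_nsmul, e.apply_symm_apply]
  exact funext hc

theorem nontrivial [Fintype R] (hR : IsGaloisRing n R) : Nontrivial R := by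
  rw [← Fintype.one_lt_card_iff_nontrivial, hR.card_eq]
  exact Nat.one_lt_pow hR.pos.ne' (by norm_num)

theorem not_isUnit_of_two_dvd [Fintype R] (hR : IsGaloisRing n R) {r : R} (hr : (2 : R) ∣ r) :
    ¬ IsUnit r := by
  have := hR.nontrivial
  obtain ⟨c, rfl⟩ := hr
  intro hu
  apply (hu.pow 2).ne_zero
  linear_combination hR.four_mul_eq_zero (c ^ 2)

end IsGaloisRing

/-! ### The Teichmüller system as a field -/

namespace TeichmullerIdentification

variable {n : ℕ} {R : Type*} [CommRing R] {ξ : Rˣ} {F : Type*} [Field F]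

theorem map_zero (φ : TeichmullerIdentification n ξ F) : φ.toFun 0 = 0 := by
  obtain ⟨u, -, hu⟩ := φ.bijOn.surjOn (Or.inr rfl : (0 : R) ∈ teichmullerSystem n ξ)
  have := φ.map_mul 0 u
  rwa [zero_mul, hu, mul_zero] at this

theorem map_one (hn : 0 < n) (φ : TeichmullerIdentification n ξ F) : φ.toFun 1 = 1 := by
  have hmem : (1 : R) ∈ teichmullerSystem n ξ := by
    refine Or.inl ⟨0, ?_, by simp⟩
    have := Nat.one_lt_two_pow hn.ne'
    omega
  obtain ⟨u, -, hu⟩ := φ.bijOn.surjOn hmem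
  have := φ.map_mul 1 u
  rwa [one_mul, hu, mul_one, eq_comm] at this

theorem map_pow (hn : 0 < n) (φ : TeichmullerIdentification n ξ F) (x : F) (k : ℕ) :
    φ.toFun (x ^ k) = φ.toFun x ^ k := by
  induction k with
  | zero => simp [φ.map_one hn]
  | succ k ih => rw [pow_succ, φ.map_mul, ih, pow_succ]

theorem isUnit_of_ne_zero (hn : 0 < n) (φ : TeichmullerIdentification n ξ F) {x : F}
    (hx : x ≠ 0) : IsUnit (φ.toFun x) := by
  refine IsUnit.of_mul_eq_one (φ.toFun x⁻¹) ?_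
  rw [← φ.map_mul, mul_inv_cancel₀ hx, φ.map_one hn]

theorem galoisSqrt_toFun (hn : 0 < n) (φ : TeichmullerIdentification n ξ F) (x : F) :
    galoisSqrt n (φ.toFun x) = φ.toFun (galoisSqrt n x) :=
  (φ.map_pow hn x _).symm

theorem map_add_eq (hn : 0 < n) (φ : TeichmullerIdentification n ξ F) (x y : F) :
    φ.toFun (x + y) = φ.toFun x + φ.toFun y + 2 * φ.toFun (galoisSqrt n (x * y)) := by
  rw [φ.map_add, teichmullerAdd, ← φ.map_mul, φ.galoisSqrt_toFun hn]

theorem two_mul_map_add (hR : IsGaloisRing n R) (φ : TeichmullerIdentification n ξ F) (x y : F) :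
    2 * φ.toFun (x + y) = 2 * φ.toFun x + 2 * φ.toFun y := by
  rw [φ.map_add_eq hR.pos]
  linear_combination hR.four_mul_eq_zero (φ.toFun (galoisSqrt n (x * y)))

variable [Fintype R]

/-- Distinct Teichmüller elements are distinct modulo `2`: for `x = y + ε` in `F` the
representatives differ modulo `2` by that of `ε`, a unit unless `ε = 0`. -/
theorem eq_of_two_dvd_sub (hR : IsGaloisRing n R) (φ : TeichmullerIdentification n ξ F) {x y : F}
    (h : (2 : R) ∣ φ.toFun x - φ.toFun y) : x = y := by
  by_contra hne
  refine hR.not_isUnit_of_two_dvd ?_ (φ.isUnit_of_ne_zero hR.pos (sub_ne_zero.mpr hne))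
  have hadd := φ.map_add_eq hR.pos y (x - y)
  rw [add_sub_cancel] at hadd
  obtain ⟨c, hc⟩ := h
  exact ⟨c - φ.toFun (galoisSqrt n (y * (x - y))), by linear_combination hc - hadd⟩

theorem two_mul_injective (hR : IsGaloisRing n R) (φ : TeichmullerIdentification n ξ F) {x y : F}
    (h : 2 * φ.toFun x = 2 * φ.toFun y) : x = y :=
  φ.eq_of_two_dvd_sub hR (hR.two_dvd_of_two_mul_eq_zero (by linear_combination h))

variable [Fintype F]

/-- The `2`-adic expansion: every element of `R` is `x + 2y` with `x`, `y` Teichmüller elements. -/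
theorem exists_eq_add_two_mul (hR : IsGaloisRing n R) (hF : Fintype.card F = 2 ^ n)
    (φ : TeichmullerIdentification n ξ F) (r : R) :
    ∃ x y : F, r = φ.toFun x + 2 * φ.toFun y := by
  let e : F × F → R := fun p => φ.toFun p.1 + 2 * φ.toFun p.2
  have hinj : Function.Injective e := by
    rintro ⟨x, y⟩ ⟨x', y'⟩ h
    simp only [e] at h
    obtain rfl : x = x' :=
      φ.eq_of_two_dvd_sub hR ⟨φ.toFun y' - φ.toFun y, by linear_combination h⟩
    rw [φ.two_mul_injective hR (add_left_cancel h)]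
  have hcard : Fintype.card (F × F) = Fintype.card R := by
    rw [Fintype.card_prod, hF, hR.card_eq, ← mul_pow]
    norm_num
  obtain ⟨⟨x, y⟩, h⟩ := ((Fintype.bijective_iff_injective_and_card e).mpr ⟨hinj, hcard⟩).2 r
  exact ⟨x, y, h.symm⟩

end TeichmullerIdentification

/-- The square root is the inverse of the Frobenius automorphism, hence a bijection. -/
theorem galoisSqrt_bijective {n : ℕ} {F : Type*} [Field F] [Fintype F]
    (hF : Fintype.card F = 2 ^ n) : Function.Bijective (galoisSqrt n : F → F) := by
  have : CharP F 2 := charP_of_card_eq_prime_pow hF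
  exact Finite.injective_iff_bijective.mp (iterateFrobenius_inj F 2 (n - 1))

theorem galoisSqrt_add {n : ℕ} {F : Type*} [Field F] [Fintype F]
    (hF : Fintype.card F = 2 ^ n) (x y : F) :
    galoisSqrt n (x + y) = galoisSqrt n x + galoisSqrt n y := by
  have : CharP F 2 := charP_of_card_eq_prime_pow hF
  exact add_pow_char_pow x y 2 (n - 1)

/-! ### Characters restricted to `2R` -/

namespace TeichmullerIdentification

variable {n : ℕ} {R : Type*} [CommRing R] {ξ : Rˣ} {F : Type*} [Field F]

/-- The additive character `u ↦ χ (2u)` of `F`, which is the restriction of `χ` to `2R`. -/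
def twoChar (hR : IsGaloisRing n R) (φ : TeichmullerIdentification n ξ F) (χ : AddChar R ℂ) :
    AddChar F ℂ where
  toFun u := χ (2 * φ.toFun u)
  map_zero_eq_one' := by simp [φ.map_zero]
  map_add_eq_mul' x y := by rw [φ.two_mul_map_add hR, χ.map_add_eq_mul]

theorem twoChar_apply (hR : IsGaloisRing n R) (φ : TeichmullerIdentification n ξ F)
    (χ : AddChar R ℂ) (u : F) : φ.twoChar hR χ u = χ (2 * φ.toFun u) := rfl

/-- A character of `R` that is trivial on `2R` is additive on the Teichmüller system. -/
def residueChar (hR : IsGaloisRing n R) (φ : TeichmullerIdentification n ξ F) (χ : AddChar R ℂ)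
    (hχ : φ.twoChar hR χ = 0) : AddChar F ℂ where
  toFun u := χ (φ.toFun u)
  map_zero_eq_one' := by simp [φ.map_zero]
  map_add_eq_mul' x y := by
    rw [φ.map_add_eq hR.pos, χ.map_add_eq_mul, χ.map_add_eq_mul, ← φ.twoChar_apply hR, hχ]
    simp

variable [Fintype R] [Fintype F]

open Classical in
/-- There are `2 ^ n` characters trivial on `2R`: count the pairs `(χ, u)` weighted by `χ (2u)`. -/
theorem card_twoChar_eq_zero (hR : IsGaloisRing n R) (hF : Fintype.card F = 2 ^ n)
    (φ : TeichmullerIdentification n ξ F) :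
    (Finset.univ.filter fun χ : AddChar R ℂ => φ.twoChar hR χ = 0).card = 2 ^ n := by
  have h1 : ∑ χ : AddChar R ℂ, ∑ u : F, φ.twoChar hR χ u =
      (Finset.univ.filter fun χ : AddChar R ℂ => φ.twoChar hR χ = 0).card * (2 : ℂ) ^ n := by
    simp_rw [AddChar.sum_eq_ite, hF]
    rw [← Finset.sum_filter, Finset.sum_const, nsmul_eq_mul]
    push_cast
    rfl
  have h2 : ∑ χ : AddChar R ℂ, ∑ u : F, φ.twoChar hR χ u = (4 : ℂ) ^ n := by
    rw [Finset.sum_comm]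
    simp_rw [φ.twoChar_apply hR, AddChar.sum_apply_eq_ite, hR.card_eq]
    have hzero (u : F) : 2 * φ.toFun u = 0 ↔ u = 0 := by
      refine ⟨fun h => φ.two_mul_injective hR (by rw [h, φ.map_zero, mul_zero]), ?_⟩
      rintro rfl
      rw [φ.map_zero, mul_zero]
    simp [hzero]
  rw [h1, show (4 : ℂ) = 2 * 2 by norm_num, mul_pow] at h2
  exact_mod_cast mul_right_cancel₀ (pow_ne_zero n two_ne_zero) h2

end TeichmullerIdentification

/-! ### Character sums over `D_f` -/

namespace TeichmullerIdentification

variable {n : ℕ} {R : Type*} [CommRing R] {ξ : Rˣ} {F : Type*} [Field F]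

/-- The element `x + 2 √(f x)` of `D_f`. -/
def point (φ : TeichmullerIdentification n ξ F) (f : F → F) (x : F) : R :=
  φ.toFun x + 2 * galoisSqrt n (φ.toFun (f x))

/-- The character sum `χ(D_f)`, indexed by the Teichmüller system. -/
noncomputable def charSum [Fintype F] (φ : TeichmullerIdentification n ξ F) (f : F → F)
    (χ : AddChar R ℂ) : ℂ :=
  ∑ x : F, χ (φ.point f x)

section

variable [Fintype R] (hR : IsGaloisRing n R) (φ : TeichmullerIdentification n ξ F)
  (f : F → F)
include hR

theorem point_injective : Function.Injective (φ.point f) := by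
  intro x y h
  simp only [point] at h
  exact φ.eq_of_two_dvd_sub hR
    ⟨galoisSqrt n (φ.toFun (f y)) - galoisSqrt n (φ.toFun (f x)), by linear_combination h⟩

theorem point_eq_zero_iff (hf0 : f 0 = 0) (x : F) : φ.point f x = 0 ↔ x = 0 := by
  have h0 : φ.point f 0 = 0 := by
    rw [point, hf0, φ.map_zero, galoisSqrt, zero_pow (by positivity)]
    ring
  exact ⟨fun h => φ.point_injective hR f (h.trans h0.symm), fun h => h ▸ h0⟩

theorem point_add_point_eq_zero_iff (hf0 : f 0 = 0) (x y : F) :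
    φ.point f x + φ.point f y = 0 ↔ x = 0 ∧ y = 0 := by
  constructor
  · intro h
    obtain rfl : x = y := φ.eq_of_two_dvd_sub hR
      ⟨-φ.toFun y - galoisSqrt n (φ.toFun (f x)) - galoisSqrt n (φ.toFun (f y)), by
        simp only [point] at h
        linear_combination h⟩
    -- The terms `2 √(f x)` add up to a multiple of `4`, so `2x = 0`.
    have hx : 2 * φ.toFun x = 2 * φ.toFun 0 := by
      rw [φ.map_zero]
      simp only [point] at h
      linear_combination h - hR.four_mul_eq_zero (galoisSqrt n (φ.toFun (f x)))
    have := φ.two_mul_injective hR hx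
    exact ⟨this, this⟩
  · rintro ⟨rfl, rfl⟩
    rw [(φ.point_eq_zero_iff hR f hf0 0).mpr rfl, add_zero]

end

open Classical in
theorem sum_pseudoPlanarSet [Fintype R] [Fintype F] (hR : IsGaloisRing n R)
    (φ : TeichmullerIdentification n ξ F) (f : F → F) (χ : AddChar R ℂ) :
    ∑ g ∈ (pseudoPlanarSet n φ f).toFinset, χ g = φ.charSum f χ := by
  have : (pseudoPlanarSet n φ f).toFinset = Finset.univ.image (φ.point f) := by
    ext r
    rw [Set.mem_toFinset]
    simp [pseudoPlanarSet, point, eq_comm]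
  rw [this, Finset.sum_image fun x _ y _ h => φ.point_injective hR f h, charSum]

theorem characterSpectrum_eq [Fintype R] [Fintype F] (hR : IsGaloisRing n R)
    (φ : TeichmullerIdentification n ξ F) (f : F → F) :
    characterSpectrum (pseudoPlanarSet n φ f) =
      (Finset.univ : Finset (AddChar R ℂ)).val.map (φ.charSum f) := by
  classical
  rw [characterSpectrum]
  exact Multiset.map_congr rfl fun χ _ => by convert φ.sum_pseudoPlanarSet hR f χ

variable [Fintype F]

theorem point_add_sub_point (hR : IsGaloisRing n R) (hF : Fintype.card F = 2 ^ n)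
    (φ : TeichmullerIdentification n ξ F) (f : F → F) (x ε : F) :
    φ.point f (x + ε) - φ.point f x =
      φ.toFun ε + 2 * φ.toFun (galoisSqrt n (f (x + ε) + f x + ε * x)) := by
  simp only [point, φ.galoisSqrt_toFun hR.pos, galoisSqrt_add hF, φ.two_mul_map_add hR,
    φ.map_add_eq hR.pos x ε, mul_comm ε x]
  linear_combination -hR.four_mul_eq_zero (φ.toFun (galoisSqrt n (f x)))

theorem charSum_zero (hF : Fintype.card F = 2 ^ n) (φ : TeichmullerIdentification n ξ F)
    (f : F → F) : φ.charSum f (0 : AddChar R ℂ) = 2 ^ n := by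
  simp [charSum, hF]

/-- Characters of a group of exponent `4` take values in `{±1, ±i}`, so `χ(D_f)` is a Gaussian
integer. -/
theorem charSum_gaussian (hR : IsGaloisRing n R) (φ : TeichmullerIdentification n ξ F)
    (f : F → F) (χ : AddChar R ℂ) : ∃ a b : ℤ, φ.charSum f χ = a + b * Complex.I := by
  have hval (r : R) : ∃ a b : ℤ, χ r = a + b * Complex.I := by
    have h4 : χ r ^ 4 = 1 := by
      rw [← χ.map_nsmul_eq_pow, nsmul_eq_mul]
      simpa using congrArg χ (hR.four_mul_eq_zero r)
    have hfac : (χ r - 1) * ((χ r + 1) * ((χ r - Complex.I) * (χ r + Complex.I))) = 0 := by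
      linear_combination h4 - (χ r ^ 2 - 1) * Complex.I_sq
    rcases mul_eq_zero.mp hfac with h | h
    · exact ⟨1, 0, by push_cast; linear_combination h⟩
    rcases mul_eq_zero.mp h with h | h
    · exact ⟨-1, 0, by push_cast; linear_combination h⟩
    rcases mul_eq_zero.mp h with h | h
    · exact ⟨0, 1, by push_cast; linear_combination h⟩
    · exact ⟨0, -1, by push_cast; linear_combination h⟩
  choose a b hab using hval
  refine ⟨∑ x, a (φ.point f x), ∑ x, b (φ.point f x), ?_⟩
  simp_rw [charSum, hab]
  push_cast
  rw [Finset.sum_add_distrib, Finset.sum_mul]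

variable [Fintype R]

/-- The relative difference set property in terms of characters: if `χ` is nontrivial on `2R`, then
in `|χ(D_f)|² = ∑_ε ∑_x χ(d_{x+ε} - d_x)` pseudo-planarity makes the inner sum vanish for
`ε ≠ 0`, as `d_{x+ε} - d_x` runs over the coset `ε + 2R`. -/
theorem charSum_mul_conj (hR : IsGaloisRing n R) (hF : Fintype.card F = 2 ^ n)
    (φ : TeichmullerIdentification n ξ F) {f : F → F} (hf : IsPseudoPlanar f) {χ : AddChar R ℂ}
    (hχ : φ.twoChar hR χ ≠ 0) :
    φ.charSum f χ * starRingEnd ℂ (φ.charSum f χ) = 2 ^ n := by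
  have hinner (ε : F) (hε : ε ≠ 0) :
      ∑ x, χ (φ.point f (x + ε) - φ.point f x) = 0 := by
    simp_rw [φ.point_add_sub_point hR hF, χ.map_add_eq_mul, ← φ.twoChar_apply hR]
    rw [← Finset.mul_sum]
    have hb := (galoisSqrt_bijective hF).comp (hf ε hε)
    rw [show ∑ x, φ.twoChar hR χ (galoisSqrt n (f (x + ε) + f x + ε * x)) =
      ∑ u, φ.twoChar hR χ u from hb.sum_comp (φ.twoChar hR χ),
      AddChar.sum_eq_zero_iff_ne_zero.mpr hχ, mul_zero]
  calc φ.charSum f χ * starRingEnd ℂ (φ.charSum f χ)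
      = ∑ x, ∑ y, χ (φ.point f y - φ.point f x) := by
        rw [charSum, map_sum, Finset.sum_mul_sum, Finset.sum_comm]
        simp_rw [← AddChar.map_neg_eq_conj, ← AddChar.map_add_eq_mul, sub_eq_add_neg]
    _ = ∑ x, ∑ ε, χ (φ.point f (x + ε) - φ.point f x) :=
        Finset.sum_congr rfl fun x _ =>
          (Equiv.sum_comp (Equiv.addLeft x) fun y => χ (φ.point f y - φ.point f x)).symm
    _ = ∑ ε, ∑ x, χ (φ.point f (x + ε) - φ.point f x) := Finset.sum_comm
    _ = ∑ x, χ (φ.point f (x + 0) - φ.point f x) :=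
        Finset.sum_eq_single 0 (fun ε _ hε => hinner ε hε) (by simp)
    _ = 2 ^ n := by simp [hF]

theorem charSum_eq_zero (hR : IsGaloisRing n R) (hF : Fintype.card F = 2 ^ n)
    (φ : TeichmullerIdentification n ξ F) (f : F → F) {χ : AddChar R ℂ}
    (hχ : φ.twoChar hR χ = 0) (hne : χ ≠ 0) : φ.charSum f χ = 0 := by
  have htwo (u : F) : χ (2 * φ.toFun u) = 1 := by
    rw [← φ.twoChar_apply hR, hχ, AddChar.zero_apply]
  have hres : φ.residueChar hR χ hχ ≠ 0 := by
    intro h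
    apply hne
    ext r
    obtain ⟨x, y, rfl⟩ := φ.exists_eq_add_two_mul hR hF r
    have hx : χ (φ.toFun x) = 1 := DFunLike.congr_fun h x
    rw [χ.map_add_eq_mul, htwo, hx, mul_one, AddChar.zero_apply]
  rw [← AddChar.sum_eq_zero_iff_ne_zero.mpr hres, charSum]
  refine Finset.sum_congr rfl fun x _ => ?_
  rw [point, φ.galoisSqrt_toFun hR.pos, χ.map_add_eq_mul, htwo, mul_one]
  rfl

/-- For `χ` nontrivial on `2R`, the value `χ(D_f)` is a Gaussian integer of norm `2 ^ n`. -/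
theorem exists_charSum_eq (hR : IsGaloisRing n R) (hF : Fintype.card F = 2 ^ n)
    (φ : TeichmullerIdentification n ξ F) {f : F → F} (hf : IsPseudoPlanar f) {χ : AddChar R ℂ}
    (hχ : φ.twoChar hR χ ≠ 0) :
    ∃ a b : ℤ, φ.charSum f χ = a + b * Complex.I ∧ a ^ 2 + b ^ 2 = 2 ^ n := by
  obtain ⟨a, b, hab⟩ := φ.charSum_gaussian hR f χ
  refine ⟨a, b, hab, ?_⟩
  have h := φ.charSum_mul_conj hR hF hf hχ
  rw [hab] at h
  simp only [_root_.map_add, _root_.map_mul, Complex.conj_I, map_intCast] at h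
  have h' : (a : ℂ) ^ 2 + (b : ℂ) ^ 2 = 2 ^ n := by
    linear_combination h + (b : ℂ) ^ 2 * Complex.I_sq
  exact_mod_cast h'

theorem charSum_eq_zero_iff (hR : IsGaloisRing n R) (hF : Fintype.card F = 2 ^ n)
    (φ : TeichmullerIdentification n ξ F) {f : F → F} (hf : IsPseudoPlanar f) (χ : AddChar R ℂ) :
    φ.charSum f χ = 0 ↔ φ.twoChar hR χ = 0 ∧ χ ≠ 0 := by
  refine ⟨fun h => ⟨?_, ?_⟩, fun h => φ.charSum_eq_zero hR hF f h.1 h.2⟩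
  · by_contra hχ
    have := φ.charSum_mul_conj hR hF hf hχ
    rw [h, zero_mul] at this
    exact pow_ne_zero n two_ne_zero this.symm
  · rintro rfl
    rw [φ.charSum_zero hF] at h
    exact pow_ne_zero n two_ne_zero h

theorem charSum_eq_two_pow_iff (hR : IsGaloisRing n R) (hF : Fintype.card F = 2 ^ n)
    (φ : TeichmullerIdentification n ξ F) {f : F → F} (hf : IsPseudoPlanar f) (χ : AddChar R ℂ) :
    φ.charSum f χ = 2 ^ n ↔ χ = 0 := by
  refine ⟨fun h => ?_, fun h => h ▸ φ.charSum_zero hF f⟩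
  have h2 : (2 : ℂ) ^ n ≠ 0 := pow_ne_zero n two_ne_zero
  by_contra hne
  by_cases hχ : φ.twoChar hR χ = 0
  · rw [φ.charSum_eq_zero hR hF f hχ hne] at h
    exact h2 h.symm
  · have := φ.charSum_mul_conj hR hF hf hχ
    rw [h, _root_.map_pow, Complex.conj_ofNat] at this
    -- `4 ^ n = 2 ^ n` is impossible as `n > 0`.
    have h1 : (2 : ℂ) ^ n = 1 := mul_left_cancel₀ h2 (by rw [this, mul_one])
    exact (Nat.one_lt_two_pow hR.pos.ne').ne' (by exact_mod_cast h1)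

/-! ### Moments of the spectrum -/

theorem conj_charSum (φ : TeichmullerIdentification n ξ F) (f : F → F) (χ : AddChar R ℂ) :
    starRingEnd ℂ (φ.charSum f χ) = φ.charSum f (-χ) := by
  simp_rw [charSum, map_sum, ← AddChar.map_neg_eq_conj, AddChar.neg_apply]

theorem sum_charSum (hR : IsGaloisRing n R) (φ : TeichmullerIdentification n ξ F) {f : F → F}
    (hf0 : f 0 = 0) : ∑ χ : AddChar R ℂ, φ.charSum f χ = 4 ^ n := by
  classical
  simp_rw [charSum]
  rw [Finset.sum_comm]
  simp [AddChar.sum_apply_eq_ite, hR.card_eq, φ.point_eq_zero_iff hR f hf0]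

theorem sum_charSum_sq (hR : IsGaloisRing n R) (φ : TeichmullerIdentification n ξ F) {f : F → F}
    (hf0 : f 0 = 0) : ∑ χ : AddChar R ℂ, φ.charSum f χ ^ 2 = 4 ^ n := by
  classical
  simp_rw [charSum, sq, Finset.sum_mul_sum, ← AddChar.map_add_eq_mul]
  rw [Finset.sum_comm]
  simp_rw [Finset.sum_comm (s := (Finset.univ : Finset (AddChar R ℂ))),
    AddChar.sum_apply_eq_ite, hR.card_eq, φ.point_add_point_eq_zero_iff hR f hf0, ite_and]
  simp

section Multiset

variable (hR : IsGaloisRing n R) (φ : TeichmullerIdentification n ξ F) (f : F → F)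
include hR

theorem card_characterSpectrum :
    (characterSpectrum (pseudoPlanarSet n φ f)).card = 4 ^ n := by
  rw [φ.characterSpectrum_eq hR, Multiset.card_map, ← hR.card_eq, ← AddChar.card_eq]
  rfl

theorem map_conj_characterSpectrum :
    (characterSpectrum (pseudoPlanarSet n φ f)).map (starRingEnd ℂ) =
      characterSpectrum (pseudoPlanarSet n φ f) := by
  rw [φ.characterSpectrum_eq hR, Multiset.map_map,
    show starRingEnd ℂ ∘ φ.charSum f = φ.charSum f ∘ Equiv.neg (AddChar R ℂ) from
      funext (φ.conj_charSum f), ← Multiset.map_map]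
  exact congrArg _ (congrArg Finset.val (Finset.map_univ_equiv (Equiv.neg (AddChar R ℂ))))

variable {f}

theorem sum_characterSpectrum (hf0 : f 0 = 0) :
    (characterSpectrum (pseudoPlanarSet n φ f)).sum = 4 ^ n := by
  rw [φ.characterSpectrum_eq hR]
  exact φ.sum_charSum hR hf0

theorem sum_sq_characterSpectrum (hf0 : f 0 = 0) :
    ((characterSpectrum (pseudoPlanarSet n φ f)).map (· ^ 2)).sum = 4 ^ n := by
  rw [φ.characterSpectrum_eq hR, Multiset.map_map]
  exact φ.sum_charSum_sq hR hf0

open Classical in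
theorem count_two_pow_characterSpectrum (hF : Fintype.card F = 2 ^ n) (hf : IsPseudoPlanar f) :
    (characterSpectrum (pseudoPlanarSet n φ f)).count (2 ^ n) = 1 := by
  rw [φ.characterSpectrum_eq hR, Multiset.count_map, ← Finset.filter_val, Finset.card_val]
  simp_rw [eq_comm (a := (2 : ℂ) ^ n), φ.charSum_eq_two_pow_iff hR hF hf]
  simp [Finset.filter_eq']

open Classical in
theorem count_zero_characterSpectrum (hF : Fintype.card F = 2 ^ n) (hf : IsPseudoPlanar f) :
    (characterSpectrum (pseudoPlanarSet n φ f)).count 0 + 1 = 2 ^ n := by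
  rw [φ.characterSpectrum_eq hR, Multiset.count_map, ← Finset.filter_val, Finset.card_val]
  simp_rw [eq_comm (a := (0 : ℂ)), φ.charSum_eq_zero_iff hR hF hf]
  rw [← φ.card_twoChar_eq_zero hR hF, ← Finset.filter_filter, Finset.filter_ne',
    Finset.card_erase_add_one]
  simp only [Finset.mem_filter, Finset.mem_univ, true_and]
  ext u
  simp [φ.twoChar_apply hR]

theorem mem_characterSpectrum (hF : Fintype.card F = 2 ^ n) (hf : IsPseudoPlanar f) {z : ℂ}
    (hz : z ∈ characterSpectrum (pseudoPlanarSet n φ f)) :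
    z = 2 ^ n ∨ z = 0 ∨ ∃ a b : ℤ, z = a + b * Complex.I ∧ a ^ 2 + b ^ 2 = 2 ^ n := by
  rw [φ.characterSpectrum_eq hR] at hz
  obtain ⟨χ, -, rfl⟩ := Multiset.mem_map.mp hz
  by_cases hχ : φ.twoChar hR χ = 0
  · rcases eq_or_ne χ 0 with rfl | hne
    · exact Or.inl (φ.charSum_zero hF f)
    · exact Or.inr (Or.inl (φ.charSum_eq_zero hR hF f hχ hne))
  · exact Or.inr (Or.inr (φ.exists_charSum_eq hR hF hf hχ))

end Multiset

end TeichmullerIdentification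

/-! ### Gaussian integers whose norm is a power of two -/

theorem Int.even_of_sq_add_sq_eq_four_mul {x y m : ℤ} (h : x ^ 2 + y ^ 2 = 4 * m) :
    Even x ∧ Even y := by
  rcases Int.even_or_odd' x with ⟨c, rfl | rfl⟩ <;> rcases Int.even_or_odd' y with ⟨d, rfl | rfl⟩
  · exact ⟨even_two_mul c, even_two_mul d⟩
  all_goals ring_nf at h; omega

theorem Int.sq_add_sq_eq_four_pow {m : ℕ} {x y : ℤ} (h : x ^ 2 + y ^ 2 = 4 ^ m) :
    (x = 2 ^ m ∧ y = 0) ∨ (x = -2 ^ m ∧ y = 0) ∨ (x = 0 ∧ y = 2 ^ m) ∨ (x = 0 ∧ y = -2 ^ m) := by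
  induction m generalizing x y with
  | zero =>
    have hx : x ≤ 1 := by nlinarith
    have hx' : -1 ≤ x := by nlinarith
    have hy : y ≤ 1 := by nlinarith
    have hy' : -1 ≤ y := by nlinarith
    interval_cases x <;> interval_cases y <;> simp_all
  | succ m ih =>
    rw [pow_succ' 4] at h
    obtain ⟨⟨c, rfl⟩, ⟨d, rfl⟩⟩ := Int.even_of_sq_add_sq_eq_four_mul h
    have := @ih c d (by linarith)
    rw [pow_succ]
    omega

theorem Int.sq_add_sq_eq_two_mul_four_pow {m : ℕ} {x y : ℤ} (h : x ^ 2 + y ^ 2 = 2 * 4 ^ m) :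
    (x = 2 ^ m ∨ x = -2 ^ m) ∧ (y = 2 ^ m ∨ y = -2 ^ m) := by
  induction m generalizing x y with
  | zero =>
    have hx : x ≤ 1 := by nlinarith
    have hx' : -1 ≤ x := by nlinarith
    have hy : y ≤ 1 := by nlinarith
    have hy' : -1 ≤ y := by nlinarith
    interval_cases x <;> interval_cases y <;> simp_all
  | succ m ih =>
    rw [pow_succ' 4, mul_left_comm] at h
    obtain ⟨⟨c, rfl⟩, ⟨d, rfl⟩⟩ := Int.even_of_sq_add_sq_eq_four_mul h
    have := @ih c d (by linarith)
    rw [pow_succ]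
    omega

/-! ### Multisets of complex numbers determined by their first moments -/

theorem Multiset.eq_sum_replicate_count {α : Type*} [DecidableEq α] {M : Multiset α} {l : List α}
    (hl : l.Nodup) (hM : ∀ z ∈ M, z ∈ l) :
    M = (l.map fun z => Multiset.replicate (M.count z) z).sum := by
  conv_lhs => rw [← Multiset.toFinset_sum_count_nsmul_eq M]
  rw [← List.sum_toFinset _ hl]
  simp only [Multiset.nsmul_singleton]
  refine Finset.sum_subset (fun z hz => ?_) (fun z _ hz => ?_)
  · simpa using hM z (by simpa using hz)
  · rw [Multiset.mem_toFinset] at hz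
    simp [Multiset.count_eq_zero_of_notMem hz]

theorem Multiset.count_conj {M : Multiset ℂ} [DecidableEq ℂ]
    (hM : M.map (starRingEnd ℂ) = M) (z : ℂ) :
    M.count (starRingEnd ℂ z) = M.count z := by
  conv_lhs => rw [← hM]
  exact Multiset.count_map_eq_count' _ _ (starRingEnd ℂ).injective z

open Classical in
/-- The two unknown multiplicities are found from the cardinality and the sum. -/
theorem eq_oddSpectrum {M : Multiset ℂ} {b : ℕ} (hb : 0 < b)
    (hmem : ∀ z ∈ M, z ∈ [2 * (b : ℂ) ^ 2, 0, b + b * Complex.I, b - b * Complex.I,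
      -b + b * Complex.I, -b - b * Complex.I])
    (hcard : M.card = 4 * b ^ 4) (hsum : M.sum = 4 * (b : ℂ) ^ 4)
    (hconj : M.map (starRingEnd ℂ) = M)
    (htop : M.count (2 * (b : ℂ) ^ 2) = 1) (hzero : M.count 0 + 1 = 2 * b ^ 2) :
    M = oddSpectrum b := by
  have hbR : (b : ℝ) ≠ 0 := by exact_mod_cast hb.ne'
  have hre (x : ℕ) : (((x : ℂ) ^ 2).re) = (x : ℝ) ^ 2 := by norm_cast
  have him (x : ℕ) : (((x : ℂ) ^ 2).im) = 0 := by norm_cast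
  have hnd : [2 * (b : ℂ) ^ 2, 0, b + b * Complex.I, b - b * Complex.I,
      -b + b * Complex.I, -b - b * Complex.I].Nodup := by
    simp only [List.nodup_cons, List.mem_cons, Complex.ext_iff, List.not_mem_nil, not_or]
    simp [hre, him, hbR, hbR.symm, self_eq_neg, neg_eq_self]
  have hM := Multiset.eq_sum_replicate_count hnd hmem
  have h1 : M.count (b - b * Complex.I) = M.count (b + b * Complex.I) := by
    rw [← Multiset.count_conj hconj]; simp [sub_eq_add_neg]
  have h2 : M.count (-b - b * Complex.I) = M.count (-b + b * Complex.I) := by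
    rw [← Multiset.count_conj hconj]; simp [sub_eq_add_neg]
  simp only [List.map_cons, List.map_nil, List.sum_cons, List.sum_nil, h1, h2, htop, add_zero] at hM
  generalize M.count 0 = Z at *
  generalize M.count ((b : ℂ) + b * Complex.I) = P at *
  generalize M.count (-(b : ℂ) + b * Complex.I) = N at *
  have hc := congrArg Multiset.card hM
  have hs := congrArg Multiset.sum hM
  rw [hcard] at hc
  rw [hsum] at hs
  simp at hc hs
  have hs' : (2 * b ^ 2 + 2 * b * P : ℤ) = 4 * b ^ 4 + 2 * b * N := by
    have : (2 * b ^ 2 + 2 * b * P : ℂ) = 4 * b ^ 4 + 2 * b * N := by linear_combination -hs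
    exact_mod_cast this
  have hc' : (4 * b ^ 4 : ℤ) = 2 * b ^ 2 + 2 * P + 2 * N := by
    zify at hc hzero
    linarith
  have hbZ : (b : ℤ) ≠ 0 := by exact_mod_cast hb.ne'
  have hd : (b + P : ℤ) = 2 * b ^ 3 + N :=
    mul_left_cancel₀ (mul_ne_zero two_ne_zero hbZ) (by linear_combination hs')
  have hP : ((b : ℤ) * (2 * b ^ 3 + 2 * b ^ 2 - b - 1) / 2).toNat = P := by
    rw [show (b : ℤ) * (2 * b ^ 3 + 2 * b ^ 2 - b - 1) = 2 * P by linarith]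
    simp
  have hN : ((b : ℤ) * (2 * b ^ 3 - 2 * b ^ 2 - b + 1) / 2).toNat = N := by
    rw [show (b : ℤ) * (2 * b ^ 3 - 2 * b ^ 2 - b + 1) = 2 * N by linarith]
    simp
  have hZ : (2 * (b : ℤ) ^ 2 - 1).toNat = Z := by
    zify at hzero; omega
  rw [hM, oddSpectrum, hP, hN, hZ]
  simp only [Int.cast_natCast, add_assoc]

open Classical in
/-- The three unknown multiplicities are found from the cardinality, the sum and the sum of the
squares. -/
theorem eq_evenSpectrum {M : Multiset ℂ} {b : ℕ} (hb : 0 < b)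
    (hmem : ∀ z ∈ M, z ∈ [4 * (b : ℂ) ^ 2, 0, 2 * (b : ℂ), -(2 * (b : ℂ)), 2 * b * Complex.I,
      -(2 * b * Complex.I)])
    (hcard : M.card = 16 * b ^ 4) (hsum : M.sum = 16 * (b : ℂ) ^ 4)
    (hsq : (M.map (· ^ 2)).sum = 16 * (b : ℂ) ^ 4)
    (hconj : M.map (starRingEnd ℂ) = M)
    (htop : M.count (4 * (b : ℂ) ^ 2) = 1) (hzero : M.count 0 + 1 = 4 * b ^ 2) :
    M = evenSpectrum b := by
  have hbR' : (1 : ℝ) ≤ b := by exact_mod_cast hb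
  have hbR : (b : ℝ) ≠ 0 := by positivity
  have hre (x : ℕ) : (((x : ℂ) ^ 2).re) = (x : ℝ) ^ 2 := by norm_cast
  have him (x : ℕ) : (((x : ℂ) ^ 2).im) = 0 := by norm_cast
  have hnd : [4 * (b : ℂ) ^ 2, 0, 2 * (b : ℂ), -(2 * (b : ℂ)), 2 * b * Complex.I,
      -(2 * b * Complex.I)].Nodup := by
    simp only [List.nodup_cons, List.mem_cons, Complex.ext_iff, List.not_mem_nil, not_or]
    simp [hre, him, hbR, self_eq_neg]
    -- `4b² ≠ ±2b`, as `b ≥ 1`.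
    constructor <;> nlinarith
  have hM := Multiset.eq_sum_replicate_count hnd hmem
  have h1 : M.count (-(2 * b * Complex.I)) = M.count (2 * b * Complex.I) := by
    rw [← Multiset.count_conj hconj]; simp [Complex.conj_ofNat]
  simp only [List.map_cons, List.map_nil, List.sum_cons, List.sum_nil, h1, htop, add_zero] at hM
  generalize M.count 0 = Z at *
  generalize M.count (2 * (b : ℂ)) = P at *
  generalize M.count (-(2 * (b : ℂ))) = N at *
  generalize M.count (2 * (b : ℂ) * Complex.I) = Q at *
  have hc := congrArg Multiset.card hM
  have hs := congrArg Multiset.sum hM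
  have hq := congrArg (fun M => (M.map (· ^ 2)).sum) hM
  rw [hcard] at hc
  rw [hsum] at hs
  rw [hsq] at hq
  simp [mul_pow] at hc hs hq
  have hbZ : (b : ℤ) ≠ 0 := by exact_mod_cast hb.ne'
  have hs' : (4 * b ^ 2 + 2 * b * P : ℤ) = 16 * b ^ 4 + 2 * b * N := by
    have : (4 * b ^ 2 + 2 * b * P : ℂ) = 16 * b ^ 4 + 2 * b * N := by linear_combination -hs
    exact_mod_cast this
  have hq' : (4 * b ^ 2 * (P + N) : ℤ) = 4 * b ^ 2 * (2 * Q) := by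
    have : (4 * b ^ 2 * (P + N) : ℂ) = 4 * b ^ 2 * (2 * Q) := by linear_combination -hq
    exact_mod_cast this
  have hc' : (16 * b ^ 4 : ℤ) = 4 * b ^ 2 + P + N + 2 * Q := by
    zify at hc hzero
    linarith
  have hd : (2 * b + P : ℤ) = 8 * b ^ 3 + N :=
    mul_left_cancel₀ (mul_ne_zero two_ne_zero hbZ) (by linear_combination hs')
  have he : (P + N : ℤ) = 2 * Q := mul_left_cancel₀ (by positivity) hq'
  have hP : ((b : ℤ) * (4 * b ^ 3 + 4 * b ^ 2 - b - 1)).toNat = P := by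
    rw [show (b : ℤ) * (4 * b ^ 3 + 4 * b ^ 2 - b - 1) = P by linarith]
    simp
  have hN : ((b : ℤ) * (4 * b ^ 3 - 4 * b ^ 2 - b + 1)).toNat = N := by
    rw [show (b : ℤ) * (4 * b ^ 3 - 4 * b ^ 2 - b + 1) = N by linarith]
    simp
  have hQ : ((b : ℤ) ^ 2 * (4 * b ^ 2 - 1)).toNat = Q := by
    rw [show (b : ℤ) ^ 2 * (4 * b ^ 2 - 1) = Q by linarith]
    simp
  have hZ : (4 * (b : ℤ) ^ 2 - 1).toNat = Z := by
    zify at hzero; omega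
  rw [hM, evenSpectrum, hP, hN, hZ, hQ]
  simp only [Int.cast_natCast, add_assoc]

/-! ### The spectrum -/

theorem corollary3p5 (n : ℕ) {R : Type*} [CommRing R] [Fintype R] (hR : IsGaloisRing n R)
    (ξ : Rˣ) (hξ : orderOf ξ = 2 ^ n - 1)
    {F : Type*} [Field F] [Fintype F] (hF : Fintype.card F = 2 ^ n)
    (φ : TeichmullerIdentification n ξ F)
    (f : F → F) (hf : IsPseudoPlanar f) (hf0 : f 0 = 0) :
    (Odd n → characterSpectrum (pseudoPlanarSet n φ f) = oddSpectrum (2 ^ ((n - 1) / 2))) ∧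
    (Even n → characterSpectrum (pseudoPlanarSet n φ f) = evenSpectrum (2 ^ ((n - 2) / 2))) := by
  have hmem := fun z (hz : z ∈ characterSpectrum (pseudoPlanarSet n φ f)) =>
    φ.mem_characterSpectrum hR hF hf hz
  have hcard := φ.card_characterSpectrum hR f
  have hsum := φ.sum_characterSpectrum hR hf0
  have hsq := φ.sum_sq_characterSpectrum hR hf0
  have hconj := φ.map_conj_characterSpectrum hR f
  have htop := φ.count_two_pow_characterSpectrum hR hF hf
  have hzero := φ.count_zero_characterSpectrum hR hF hf
  generalize characterSpectrum (pseudoPlanarSet n φ f) = M at *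
  constructor
  · rintro ⟨m, rfl⟩
    have h2 {K : Type} [CommSemiring K] : (2 : K) ^ (2 * m + 1) = 2 * (2 ^ m) ^ 2 := by ring
    have h4 {K : Type} [CommSemiring K] : (4 : K) ^ (2 * m + 1) = 4 * (2 ^ m) ^ 4 := by
      rw [show (4 : K) ^ (2 * m + 1) = (2 ^ (2 * m + 1)) ^ 2 by rw [pow_right_comm]; norm_num, h2]
      ring
    have key := eq_oddSpectrum (M := M) (b := 2 ^ m) (by positivity) ?_
      (by rw [hcard, h4]) (by push_cast; rw [hsum, h4]) hconj
      (by push_cast; rwa [← h2]) (by rw [hzero, h2])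
    · rw [key, show (2 * m + 1 - 1) / 2 = m by omega]
      push_cast
      rfl
    · intro z hz
      push_cast
      simp only [List.mem_cons, List.not_mem_nil, or_false]
      rcases hmem z hz with h | h | ⟨x, y, rfl, hxy⟩
      · exact Or.inl (by rw [h, h2])
      · exact Or.inr (Or.inl h)
      · replace hxy : x ^ 2 + y ^ 2 = 2 * 4 ^ m := by
          rw [hxy, pow_succ', pow_mul]
          norm_num
        obtain ⟨rfl | rfl, rfl | rfl⟩ := Int.sq_add_sq_eq_two_mul_four_pow hxy <;>
          push_cast <;> simp [sub_eq_add_neg]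
  · intro hn
    obtain ⟨m, rfl⟩ : ∃ m, n = 2 * m + 2 := by
      obtain ⟨k, rfl⟩ := hn
      have := hR.pos
      exact ⟨k - 1, by omega⟩
    have h2 {K : Type} [CommSemiring K] : (2 : K) ^ (2 * m + 2) = 4 * (2 ^ m) ^ 2 := by
      rw [pow_add, pow_mul']
      norm_num [mul_comm]
    have h4 {K : Type} [CommSemiring K] : (4 : K) ^ (2 * m + 2) = 16 * (2 ^ m) ^ 4 := by
      rw [show (4 : K) ^ (2 * m + 2) = (2 ^ (2 * m + 2)) ^ 2 by rw [pow_right_comm]; norm_num, h2]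
      ring
    have key := eq_evenSpectrum (M := M) (b := 2 ^ m) (by positivity) ?_
      (by rw [hcard, h4]) (by push_cast; rw [hsum, h4])
      (by push_cast; rw [hsq, h4]) hconj (by push_cast; rwa [← h2]) (by rw [hzero, h2])
    · rw [key, show (2 * m + 2 - 2) / 2 = m by omega]
      push_cast
      rfl
    · intro z hz
      push_cast
      simp only [List.mem_cons, List.not_mem_nil, or_false]
      rcases hmem z hz with h | h | ⟨x, y, rfl, hxy⟩
      · exact Or.inl (by rw [h, h2])
      · exact Or.inr (Or.inl h)
      · replace hxy : x ^ 2 + y ^ 2 = 4 ^ (m + 1) := by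
          rw [hxy, show 2 * m + 2 = 2 * (m + 1) by ring, pow_mul]
          norm_num
        obtain ⟨rfl, rfl⟩ | ⟨rfl, rfl⟩ | ⟨rfl, rfl⟩ | ⟨rfl, rfl⟩ :=
          Int.sq_add_sq_eq_four_pow hxy <;> push_cast <;> simp [pow_succ']
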